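/- **Setting.** Let $\mathcal S,\mathcal A$ be finite sets (functions on $\mathcal S\times\mathcal A$ are vectors, linear operators are matrices). Let $P_1,P_2$ be transition kernels from $\mathcal S\times\mathcal A$ to $\mathcal S$ (source and target), $\gamma_1,\gamma_2\in(0,1)$, $\tau_2>0$, let $\pi_{1,\rm ref},\pi_{2,\rm ref}$ be full-support reference policies, $\pi_{b1}$ the full-support source behavior policy, $\mu$ an anchor policy, $g:\mathcal S\to\mathbb R$, $C\in\mathbb R$. Write $(\mu q)(s)=\sum_a\mu(a\mid s)q(s,a)$, $(\Pi_\mu q)(s,a)=(\mu q)(s)$, $(P_kv)(s,a)=\sum_{s'}P_k(s'\mid s,a)v(s')$, $P_1^\mu=P_1\mu$, $\Omega(q)(s)=\tau_2\log\sum_a\pi_{2,\rm ref}(a\mid s)e^{q(s,a)/\tau_2}$ and $u_g^\star(s,a)=\log\{\pi_{b1}(a\mid s)/\pi_{1,\rm ref}(a\mid s)\}-g(s)$. Put $$b_1(q_1)=u_g^\star+\gamma_1P_1^\mu q_1-q_1,\qquad b_2(q_1,q_2)=(I-\Pi_\mu)q_1+g+C+\gamma_2P_2\Omega(q_2)-q_2,$$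 $$\widetilde b_2(q_2)=g+C+\gamma_2P_2\Omega(q_2)-q_2+(I-\Pi_\mu)(I-\gamma_1P_1^\mu)^{-1}u_g^\star .$$ Let $q_1^\star=(I-\gamma_1P_1^\mu)^{-1}u_g^\star$, let $q_2^\star$ be the solution of $b_2(q_1^\star,q_2^\star)=0$, and $P_2^{\pi_2^\star}=P_2\,D\Omega(q_2^\star)$. **Data and estimators.** $W_{k,i}=((s,a),s')$, $i=1,\dots,n_k$, $k=1,2$, are i.i.d. with $(s,a)\sim\rho_k$, $s'\sim P_k(\cdot\mid s,a)$, the two samples being independent, and $\rho_1(s,a)=\rho_1^{\mathcal S}(s)\pi_{b1}(a\mid s)$. Let $\widehat P_k$ be the empirical transition frequencies (zero at unvisited pairs), $\widehat P_1^\mu=\widehat P_1\mu$, and let $\widehat b_1,\widehat b_2,\widehat{\widetilde b}_2$ be $b_1,b_2,\widetilde b_2$ with $P_1,P_2$ replaced by $\widehat P_1,\widehat P_2$. For classes $\mathcal Q_1,\mathcal Q_2,\mathcal L_1,\mathcal L_2$ of functions on $\mathcal S\times\mathcal A$ and $\beta\ge0$, with $\langle f,h\rangle_{\rho}=\sum_{s,a}\rho(s,a)f(s,a)h(s,a)$,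 the modular estimator is $$(\widehat q_1^{\rm mod},\widehat l_1^{\rm mod})\in\arg\min_{q_1\in\mathcal Q_1}\max_{l_1\in\mathcal L_1}\{\tfrac12\|q_1\|_{\rho_1}^2+\langle l_1,\widehat b_1(q_1)\rangle_{\rho_1}\},$$ $$(\widehat q_2^{\rm mod},\widehat l_2^{\rm mod})\in\arg\min_{q_2\in\mathcal Q_2}\max_{l_2\in\mathcal L_2}\{\tfrac12\|q_2\|_{\rho_2}^2+\langle l_2,\widehat b_2(\widehat q_1^{\rm mod},q_2)\rangle_{\rho_2}\},$$ and the coupled estimator $(\widehat q_1^{\rm coup},\widehat q_2^{\rm coup},\widehat l_1^{\rm coup},\widehat l_2^{\rm coup})$ is an element of $$\arg\min_{q_1\in\mathcal Q_1,q_2\in\mathcal Q_2}\max_{l_1\in\mathcal L_1,l_2\in\mathcal L_2}\{\tfrac\beta2\|q_1\|_{\rho_1}^2+\tfrac12\|q_2\|_{\rho_2}^2+\langle l_1,\widehat b_1(q_1)\rangle_{\rho_1}+\langle l_2,\widehat b_2(q_1,q_2)\rangle_{\rho_2}\}.$$ **Assumptions.** Let $n_1,n_2\to\infty$ with $n_2/n_1\to\lambda\in(0,\infty)$,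 and let $r=n_1^{-1/2}+n_2^{-1/2}$. 1. (Asymptotic linearity.) For functions $\psi_{1,\rm op},\psi_{1,\rm res},\psi_2$ of one transition with values in $\mathbb R^{\mathcal S\times\mathcal A}$ and mean zero under the law of the respective transition, $$\gamma_1(I-\Pi_\mu)(I-\gamma_1\widehat P_1^\mu)^{-1}(\widehat P_1^\mu-P_1^\mu)q_1^\star=\tfrac1{n_1}\sum_{i\le n_1}\psi_{1,\rm op}(W_{1,i})+o_p(n_1^{-1/2}),$$ $$(I-\Pi_\mu)(I-\gamma_1\widehat P_1^\mu)^{-1}\widehat b_1(\widehat q_1^{\rm mod})=\tfrac1{n_1}\sum_{i\le n_1}\psi_{1,\rm res}(W_{1,i})+o_p(n_1^{-1/2}),$$ $$\gamma_2(\widehat P_2-P_2)\Omega(q_2^\star)=\tfrac1{n_2}\sum_{j\le n_2}\psi_2(W_{2,j})+o_p(n_2^{-1/2}).$$ 2. (Consistency and rate.) $\widehat q_1^{\rm mod}\to q_1^\star$, $\widehat q_2^{\rm mod}\to q_2^\star$ and $\widehat q_2^{\rm coup}\to q_2^\star$ in probability, and $\|\widehat q_2^{\rm mod}-q_2^\star\|$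 and $\|\widehat q_2^{\rm coup}-q_2^\star\|$ are $O_p(r)$. 3. (Local stochastic equicontinuity.) For $Z=\widehat b_2-b_2$ at $x_0=(q_1^\star,q_2^\star)$, and for $Z=\widehat{\widetilde b}_2-\widetilde b_2$ at $x_0=q_2^\star$: for all $\varepsilon,\eta>0$ there is $\delta>0$ such that $\Pr(\sup_{\|x-x_0\|\le\delta}\|Z(x)-Z(x_0)\|>\varepsilon r)\le\eta$ for all sufficiently large sample sizes. 4. (Local optimality errors.) $\widehat b_2(\widehat q_1^{\rm mod},\widehat q_2^{\rm mod})=o_p(r)$ and $\widehat{\widetilde b}_2(\widehat q_2^{\rm coup})=o_p(r)$. **Theorem (Unconditional first-order asymptotic comparison).** Let $\Sigma_{1,\rm coup}=\operatorname{Var}(\psi_{1,\rm op}(W_1))$, $\Sigma_{1,\rm mod}=\operatorname{Var}(\psi_{1,\rm op}(W_1)-\psi_{1,\rm res}(W_1))$ and $\Sigma_2=\operatorname{Var}(\psi_2(W_2))$. Then $$\sqrt{n_2}\,(\widehat q_2^{\rm coup}-q_2^\star)\rightsquigarrow\mathcal N\Bigl(0,\,(I-\gamma_2P_2^{\pi_2^\star})^{-1}(\lambda\Sigma_{1,\rm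 coup}+\Sigma_2)\bigl[(I-\gamma_2P_2^{\pi_2^\star})^{-1}\bigr]^\top\Bigr),$$ $$\sqrt{n_2}\,(\widehat q_2^{\rm mod}-q_2^\star)\rightsquigarrow\mathcal N\Bigl(0,\,(I-\gamma_2P_2^{\pi_2^\star})^{-1}(\lambda\Sigma_{1,\rm mod}+\Sigma_2)\bigl[(I-\gamma_2P_2^{\pi_2^\star})^{-1}\bigr]^\top\Bigr).$$ -/

import Mathlib

open MeasureTheory ProbabilityTheory Filter Topology
open scoped Matrix

noncomputable section

/-! ### Finite state and action spaces: policies, transition operators, soft values -/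

section Operators

variable {S A : Type*} [Fintype S] [DecidableEq S] [Fintype A] [DecidableEq A]

/-- The operator `q ↦ π q`, `(π q)(s) = ∑ a, π(a | s) q(s, a)`. -/
def policyMatrix (π : S → PMF A) : Matrix S (S × A) ℝ :=
  Matrix.of fun s y => if y.1 = s then (π s y.2).toReal else 0

/-- The operator `Π_π`, `(Π_π q)(s, a) = (π q)(s)`. -/
def anchorMatrix (π : S → PMF A) : Matrix (S × A) (S × A) ℝ :=
  Matrix.of fun x y => policyMatrix π x.1 y

/-- The transition operator `(P v)(s, a) = ∑ s', P(s' | s, a) v(s')`. -/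
def kernelMatrix (P : S × A → PMF S) : Matrix (S × A) S ℝ :=
  Matrix.of fun x s' => (P x s').toReal

/-- The soft value operator `Ω(q)(s) = τ log ∑ a, π_ref(a | s) exp (q(s, a) / τ)`. -/
def softValue (τ : ℝ) (πref : S → PMF A) (q : S × A → ℝ) : S → ℝ :=
  fun s => τ * Real.log (∑ a, (πref s a).toReal * Real.exp (q (s, a) / τ))

/-- The law of a transition `((s, a), s')` with `(s, a) ∼ ρ` and `s' ∼ P(· | s, a)`. -/
def transitionLaw (ρ : PMF (S × A)) (P : S × A → PMF S) : PMF ((S × A) × S) :=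
  ρ.bind fun x => (P x).map fun s' => (x, s')

/-- Empirical transition frequencies of the first `n` transitions:
`P̂(s' | s, a) = #{i < n : Wᵢ = ((s, a), s')} / #{i < n : (sᵢ, aᵢ) = (s, a)}`,
with value `0` at state-action pairs that have not been visited. -/
def empiricalKernel (W : ℕ → (S × A) × S) (n : ℕ) : Matrix (S × A) S ℝ :=
  Matrix.of fun x s' =>
    (((Finset.range n).filter fun i => W i = (x, s')).card : ℝ) /
      (((Finset.range n).filter fun i => (W i).1 = x).card : ℝ)

/-- `⟨f, h⟩_ρ = ∑ x, ρ(x) f(x) h(x)`. -/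
def weightedInner (ρ : PMF (S × A)) (f h : S × A → ℝ) : ℝ :=
  ∑ x, (ρ x).toReal * (f x * h x)

end Operators

/-! ### The reward-transfer model -/

/-- Population data of the reward-transfer problem: a source and a target Markov decision
process on the same finite state and action spaces. -/
structure TransferModel (S A : Type*) where
  /-- source transition kernel -/
  P₁ : S × A → PMF S
  /-- target transition kernel -/
  P₂ : S × A → PMF S
  /-- source discount factor -/
  γ₁ : ℝ
  /-- target discount factor -/
  γ₂ : ℝ
  /-- target temperature (the source temperature is normalised to one) -/
  τ₂ : ℝ
  /-- source reference policy -/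
  πref₁ : S → PMF A
  /-- target reference policy -/
  πref₂ : S → PMF A
  /-- source (expert) behaviour policy -/
  πb₁ : S → PMF A
  /-- anchor policy -/
  μ : S → PMF A
  /-- anchor function -/
  g : S → ℝ
  /-- reward shift -/
  C : ℝ
  /-- source state distribution -/
  ρS₁ : PMF S
  /-- target state-action distribution -/
  ρ₂ : PMF (S × A)
  γ₁_mem : γ₁ ∈ Set.Ioo (0 : ℝ) 1
  γ₂_mem : γ₂ ∈ Set.Ioo (0 : ℝ) 1
  τ₂_pos : 0 < τ₂
  πref₁_pos : ∀ s a, 0 < πref₁ s a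
  πref₂_pos : ∀ s a, 0 < πref₂ s a
  πb₁_pos : ∀ s a, 0 < πb₁ s a

namespace TransferModel

variable {S A : Type*} [Fintype S] [DecidableEq S] [Fintype A] [DecidableEq A]

/-- Source state-action distribution `ρ₁(s, a) = ρ₁^S(s) π_{b1}(a | s)`. -/
def ρ₁ (M : TransferModel S A) : PMF (S × A) :=
  M.ρS₁.bind fun s => (M.πb₁ s).map fun a => (s, a)

/-- `u_g = log (π_{b1} / π_{1,ref}) - g`. -/
def ug (M : TransferModel S A) : S × A → ℝ := fun x =>
  Real.log ((M.πb₁ x.1 x.2).toReal / (M.πref₁ x.1 x.2).toReal) - M.g x.1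

/-- The operator `P^μ = P ∘ μ`, for a true or an empirical transition operator `P`. -/
def anchored (M : TransferModel S A) (P : Matrix (S × A) S ℝ) : Matrix (S × A) (S × A) ℝ :=
  P * policyMatrix M.μ

/-- The matrix `(I - Π_μ) (I - γ₁ P^μ)⁻¹`. -/
def resolvent (M : TransferModel S A) (P : Matrix (S × A) S ℝ) : Matrix (S × A) (S × A) ℝ :=
  (1 - anchorMatrix M.μ) * (1 - M.γ₁ • M.anchored P)⁻¹

/-- The source value representation `q₁⋆ = (I - γ₁ P₁^μ)⁻¹ u_g`. -/
def q₁star (M : TransferModel S A) : S × A → ℝ :=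
  (1 - M.γ₁ • M.anchored (kernelMatrix M.P₁))⁻¹ *ᵥ M.ug

/-- The target soft value operator `Ω`. -/
def Ω (M : TransferModel S A) : (S × A → ℝ) → S → ℝ := softValue M.τ₂ M.πref₂

/-- The source residual `u_g + γ₁ P^μ q₁ - q₁`: it is `b₁` for the true source transition operator
`P`, and `b̂₁` for the empirical one. -/
def b₁ (M : TransferModel S A) (P : Matrix (S × A) S ℝ) (q₁ : S × A → ℝ) : S × A → ℝ :=
  M.ug + M.γ₁ • (M.anchored P *ᵥ q₁) - q₁

/-- The target residual `(I - Π_μ) q₁ + g + C + γ₂ P Ω(q₂) - q₂`: it is `b₂` for the true target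
transition operator `P`, and `b̂₂` for the empirical one. -/
def b₂ (M : TransferModel S A) (P : Matrix (S × A) S ℝ) (q₁ q₂ : S × A → ℝ) : S × A → ℝ :=
  (1 - anchorMatrix M.μ) *ᵥ q₁ + (fun x => M.g x.1 + M.C) + M.γ₂ • (P *ᵥ M.Ω q₂) - q₂

/-- The profiled target residual
`g + C + γ₂ P' Ω(q₂) - q₂ + (I - Π_μ) (I - γ₁ P^μ)⁻¹ u_g`, for true or empirical source (`P`) and
target (`P'`) transition operators. -/
def profiledResidual (M : TransferModel S A) (P P' : Matrix (S × A) S ℝ) (q₂ : S × A → ℝ) :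
    S × A → ℝ :=
  (fun x => M.g x.1 + M.C) + M.γ₂ • (P' *ᵥ M.Ω q₂) - q₂ + M.resolvent P *ᵥ M.ug

/-- The operator `P₂^{π₂⋆} = P₂ DΩ(q₂⋆)`, as a matrix. -/
def P₂pi (M : TransferModel S A) (q₂star : S × A → ℝ) : Matrix (S × A) (S × A) ℝ :=
  kernelMatrix M.P₂ *
    LinearMap.toMatrix' ((fderiv ℝ M.Ω q₂star : (S × A → ℝ) →L[ℝ] S → ℝ) :
      (S × A → ℝ) →ₗ[ℝ] S → ℝ)

end TransferModel

/-! ### The minimax estimators -/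

/-- `(x, y)` solves `min_{x ∈ Q} max_{y ∈ L} f x y`: `y` attains the inner maximum at `x`, and
`x` minimises the inner supremum (an extended real number). -/
def IsMinimaxSolution {X Y : Type*} (f : X → Y → ℝ) (Q : Set X) (L : Set Y) (x : X) (y : Y) :
    Prop :=
  x ∈ Q ∧ y ∈ L ∧ (∀ l ∈ L, f x l ≤ f x y) ∧
    ∀ x' ∈ Q, ((f x y : ℝ) : EReal) ≤ ⨆ l ∈ L, ((f x' l : ℝ) : EReal)

namespace TransferModel

variable {S A : Type*} [Fintype S] [DecidableEq S] [Fintype A] [DecidableEq A]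

/-- The two-stage modular minimax estimator, for given empirical transition operators. -/
def IsModularEstimator (M : TransferModel S A) (Q₁ Q₂ L₁ L₂ : Set (S × A → ℝ))
    (Phat₁ Phat₂ : Matrix (S × A) S ℝ) (q₁ l₁ q₂ l₂ : S × A → ℝ) : Prop :=
  IsMinimaxSolution
      (fun q l => 1 / 2 * weightedInner M.ρ₁ q q + weightedInner M.ρ₁ l (M.b₁ Phat₁ q))
      Q₁ L₁ q₁ l₁ ∧
    IsMinimaxSolution
      (fun q l => 1 / 2 * weightedInner M.ρ₂ q q + weightedInner M.ρ₂ l (M.b₂ Phat₂ q₁ q))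
      Q₂ L₂ q₂ l₂

/-- The empirical coupled Lagrangian. -/
def coupledLagrangian (M : TransferModel S A) (β : ℝ) (Phat₁ Phat₂ : Matrix (S × A) S ℝ)
    (q l : (S × A → ℝ) × (S × A → ℝ)) : ℝ :=
  β / 2 * weightedInner M.ρ₁ q.1 q.1 + 1 / 2 * weightedInner M.ρ₂ q.2 q.2
    + weightedInner M.ρ₁ l.1 (M.b₁ Phat₁ q.1) + weightedInner M.ρ₂ l.2 (M.b₂ Phat₂ q.1 q.2)

/-- The coupled minimax estimator, for given empirical transition operators. -/
def IsCoupledEstimator (M : TransferModel S A) (β : ℝ) (Q₁ Q₂ L₁ L₂ : Set (S × A → ℝ))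
    (Phat₁ Phat₂ : Matrix (S × A) S ℝ) (q₁ l₁ q₂ l₂ : S × A → ℝ) : Prop :=
  IsMinimaxSolution (M.coupledLagrangian β Phat₁ Phat₂) (Q₁ ×ˢ Q₂) (L₁ ×ˢ L₂)
    (q₁, q₂) (l₁, l₂)

end TransferModel

/-! ### Stochastic orders, asymptotic linearity, covariance -/

section Asymptotics

variable {Ω' : Type*} [MeasurableSpace Ω']

/-- `X = o_p(r)`. -/
def IsLittleOP {E : Type*} [NormedAddCommGroup E] (Pr : Measure Ω') (X : ℕ → Ω' → E) (r : ℕ → ℝ) :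
    Prop :=
  ∀ ε : ℝ, 0 < ε → Tendsto (fun m => Pr {ω | ε * r m < ‖X m ω‖}) atTop (𝓝 0)

/-- `X = O_p(r)`. -/
def IsBigOP {E : Type*} [NormedAddCommGroup E] (Pr : Measure Ω') (X : ℕ → Ω' → E) (r : ℕ → ℝ) :
    Prop :=
  ∀ η : ℝ, 0 < η → ∃ K : ℝ, ∀ᶠ m in atTop, Pr {ω | K * r m < ‖X m ω‖} ≤ ENNReal.ofReal η

/-- Local stochastic equicontinuity, at scale `r`, of the random functions `Z m` near `x₀`:
for all `ε, η > 0` there is `δ > 0` such that, for all large `m`,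
`sup_{‖x - x₀‖ ≤ δ} ‖Z m x - Z m x₀‖` exceeds `ε r m` with probability at most `η`. -/
def StochEquicontinuousAt {F E : Type*} [NormedAddCommGroup F] [NormedAddCommGroup E]
    (Pr : Measure Ω') (Z : ℕ → Ω' → F → E) (x₀ : F) (r : ℕ → ℝ) : Prop :=
  ∀ ε : ℝ, 0 < ε → ∀ η : ℝ, 0 < η → ∃ δ : ℝ, 0 < δ ∧ ∀ᶠ m in atTop,
    Pr {ω | ∃ x, ‖x - x₀‖ ≤ δ ∧ ε * r m < ‖Z m ω x - Z m ω x₀‖} ≤ ENNReal.ofReal η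

/-- `X` is asymptotically linear with influence function `ψ`: `ψ` is centred under the law `ν` of
the observations, and `X m = (1 / n m) ∑_{i < n m} ψ (W i) + o_p((n m)^{-1/2})`. -/
def IsAsymptoticallyLinear {𝒲 ι : Type*} [MeasurableSpace 𝒲] [Fintype ι] (Pr : Measure Ω')
    (ν : Measure 𝒲) (W : ℕ → Ω' → 𝒲) (n : ℕ → ℕ) (X : ℕ → Ω' → ι → ℝ) (ψ : 𝒲 → ι → ℝ) : Prop :=
  (∀ x, ∫ w, ψ w x ∂ν = 0) ∧
    IsLittleOP Pr (fun m ω => X m ω - (n m : ℝ)⁻¹ • ∑ i ∈ Finset.range (n m), ψ (W i ω))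
      (fun m => (√(n m : ℝ))⁻¹)

end Asymptotics

/-- The covariance matrix `Var(ψ(W))` for `W ∼ ν`. -/
def varMatrix {𝒲 ι : Type*} [MeasurableSpace 𝒲] (ν : Measure 𝒲) (ψ : 𝒲 → ι → ℝ) :
    Matrix ι ι ℝ :=
  Matrix.of fun x y => cov[fun w => ψ w x, fun w => ψ w y; ν]

/-- The covariance matrix `(I - γ₂ P₂^{π₂⋆})⁻¹ Sig [(I - γ₂ P₂^{π₂⋆})⁻¹]ᵀ`. -/
def TransferModel.sandwich {S A : Type*} [Fintype S] [DecidableEq S] [Fintype A] [DecidableEq A]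
    (M : TransferModel S A) (q₂star : S × A → ℝ) (Sig : Matrix (S × A) (S × A) ℝ) :
    Matrix (S × A) (S × A) ℝ :=
  (1 - M.γ₂ • M.P₂pi q₂star)⁻¹ * Sig * ((1 - M.γ₂ • M.P₂pi q₂star)⁻¹)ᵀ

end

/-! ### Calculus of stochastic orders. -/

section StochasticOrders

variable {Ω' : Type*} [MeasurableSpace Ω'] {Pr : Measure Ω'}
  {E F : Type*} [NormedAddCommGroup E] [NormedAddCommGroup F] {r r' : ℕ → ℝ}

/-! Both estimators are approximate roots of an empirical equation whose population version vanishes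
at `q₂star`, with the same derivative `-L` in `q₂`, where `L = I - γ₂ P₂^π`. The delta method
(`HasFDerivAt.isLittleOP_remainder`), stochastic equicontinuity (`StochEquicontinuousAt.isLittleOP`)
and the small residual at the estimator show that `L (q̂₂ - q₂star)` equals, up to `o_p(r)`, the
target noise `γ₂ (P̂₂ - P₂) Ω(q₂star)` plus a source term.

The source term is computed exactly. For the coupled estimator it is the perturbation of `(I -
Π_μ)(I - γ₁ P₁^μ)⁻¹ u_g`, which `resolvent_mulVec_ug_sub` identifies with the term linearized by
`ψop`. For the modular one it is `(I - Π_μ)(q̂₁ - q₁⋆)`, which by `resolvent_mulVec_b₁` is that same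
perturbation minus the propagated first-stage residual; hence `ψop - ψres`.

It remains to invert `L`, possible because `Ω` is 1-Lipschitz in the sup norm and `γ₂ < 1`, and to
apply a two-sample central limit theorem. In `tendstoInDistribution_two_sample`, characteristic
functions factor by independence into one-dimensional limits; the scaling `√(n₂ / n₁) → √λ` puts `λ`
in front of the source covariance. -/

theorem tendsto_zero_of_forall_le_ofReal {f : ℕ → ENNReal}
    (h : ∀ η : ℝ, 0 < η → ∀ᶠ m in atTop, f m ≤ ENNReal.ofReal η) : Tendsto f atTop (𝓝 0) := by
  rw [ENNReal.tendsto_nhds_zero]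
  intro ε hε
  obtain ⟨η, hη, hle⟩ := ENNReal.lt_iff_exists_nnreal_btwn.1 hε
  filter_upwards [h η (by exact_mod_cast hη)] with m hm
  exact hm.trans (by simpa using hle.le)

theorem eventually_le_ofReal_of_tendsto_zero {f : ℕ → ENNReal} (h : Tendsto f atTop (𝓝 0))
    {η : ℝ} (hη : 0 < η) : ∀ᶠ m in atTop, f m ≤ ENNReal.ofReal η :=
  ENNReal.tendsto_nhds_zero.1 h _ (by simpa using hη)

theorem IsLittleOP.add {X Y : ℕ → Ω' → E} (hX : IsLittleOP Pr X r) (hY : IsLittleOP Pr Y r) :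
    IsLittleOP Pr (fun m ω => X m ω + Y m ω) r := by
  intro ε hε
  have h := (hX (ε / 2) (by positivity)).add (hY (ε / 2) (by positivity))
  rw [add_zero] at h
  refine tendsto_of_tendsto_of_tendsto_of_le_of_le tendsto_const_nhds h (fun _ => zero_le) ?_
  intro m
  refine (measure_mono ?_).trans (measure_union_le _ _)
  intro ω hω
  simp only [Set.mem_ofPred_eq, Set.mem_union] at hω ⊢
  by_contra! hcon
  linarith [norm_add_le (X m ω) (Y m ω), hcon.1, hcon.2]

theorem IsLittleOP.of_norm_le {X : ℕ → Ω' → E} {Y : ℕ → Ω' → F} (hX : IsLittleOP Pr X r) {c : ℝ}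
    (hc : 0 ≤ c) (h : ∀ m ω, ‖Y m ω‖ ≤ c * ‖X m ω‖) : IsLittleOP Pr Y r := by
  intro ε hε
  -- The `+ 1` in `ε / (c + 1)` keeps the threshold meaningful when `c = 0`.
  refine tendsto_of_tendsto_of_tendsto_of_le_of_le tendsto_const_nhds
    (hX (ε / (c + 1)) (by positivity)) (fun _ => zero_le) fun m => measure_mono fun ω hω => ?_
  simp only [Set.mem_ofPred_eq] at hω ⊢
  rw [div_mul_eq_mul_div, div_lt_iff₀ (by positivity)]
  nlinarith [h m ω, norm_nonneg (X m ω)]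

theorem IsLittleOP.sub {X Y : ℕ → Ω' → E} (hX : IsLittleOP Pr X r) (hY : IsLittleOP Pr Y r) :
    IsLittleOP Pr (fun m ω => X m ω - Y m ω) r := by
  have hY' : IsLittleOP Pr (fun m ω => -Y m ω) r := hY.of_norm_le zero_le_one (by simp)
  simpa only [sub_eq_add_neg] using hX.add hY'

theorem IsLittleOP.clm_comp [NormedSpace ℝ E] [NormedSpace ℝ F] {X : ℕ → Ω' → E}
    (hX : IsLittleOP Pr X r) (T : E →L[ℝ] F) : IsLittleOP Pr (fun m ω => T (X m ω)) r :=
  hX.of_norm_le (norm_nonneg T) fun _ _ => T.le_opNorm _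

theorem IsLittleOP.mono_rate {X : ℕ → Ω' → E} (hX : IsLittleOP Pr X r) (h : ∀ m, r m ≤ r' m) :
    IsLittleOP Pr X r' := by
  intro ε hε
  refine tendsto_of_tendsto_of_tendsto_of_le_of_le tendsto_const_nhds (hX ε hε)
    (fun _ => zero_le) fun m => measure_mono fun ω hω => ?_
  exact (mul_le_mul_of_nonneg_left (h m) hε.le).trans_lt hω

/-- Multiplying an `o_p(r)` sequence by scalars `a` with `a r = O(1)` gives convergence to zero in
probability. -/
theorem IsLittleOP.tendstoInMeasure_smul [NormedSpace ℝ E] {X : ℕ → Ω' → E}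
    (hX : IsLittleOP Pr X r) {a : ℕ → ℝ} (ha : ∀ m, 0 ≤ a m) {K : ℝ}
    (hK : ∀ᶠ m in atTop, a m * r m < K) :
    TendstoInMeasure Pr (fun m ω => a m • X m ω) atTop 0 := by
  rw [tendstoInMeasure_iff_norm]
  intro ε hε
  refine tendsto_of_tendsto_of_tendsto_of_le_of_le' tendsto_const_nhds
    (hX (ε / (|K| + 1)) (by positivity)) (Eventually.of_forall fun _ => zero_le) ?_
  filter_upwards [hK] with m hm
  refine measure_mono fun ω hω => ?_
  simp only [Set.mem_ofPred_eq, Pi.zero_apply, sub_zero, norm_smul, Real.norm_eq_abs,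
    abs_of_nonneg (ha m)] at hω ⊢
  -- If `a m = 0`, the event would force `ε ≤ 0`.
  have hpos : 0 < a m := by
    rcases (ha m).eq_or_lt with h0 | h0
    · rw [← h0, zero_mul] at hω; linarith
    · exact h0
  rw [div_mul_eq_mul_div, div_lt_iff₀ (by positivity)]
  by_contra! hcon
  have h1 := mul_le_mul_of_nonneg_left hcon hpos.le
  nlinarith [le_abs_self K, abs_nonneg K]

/-- Stochastic equicontinuity at `x₀` along a sequence that converges to `x₀` in probability. -/
theorem StochEquicontinuousAt.isLittleOP {Z : ℕ → Ω' → F → E} {x₀ : F}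
    (hZ : StochEquicontinuousAt Pr Z x₀ r) {X : ℕ → Ω' → F}
    (hX : TendstoInMeasure Pr X atTop fun _ => x₀) :
    IsLittleOP Pr (fun m ω => Z m ω (X m ω) - Z m ω x₀) r := by
  rw [tendstoInMeasure_iff_norm] at hX
  intro ε hε
  refine tendsto_zero_of_forall_le_ofReal fun η hη => ?_
  obtain ⟨δ, hδ, hδ'⟩ := hZ ε hε (η / 2) (by positivity)
  filter_upwards [hδ', eventually_le_ofReal_of_tendsto_zero (hX δ hδ) (half_pos hη)] with m h1 h2
  calc _ ≤ _ := measure_mono (t := _ ∪ _) ?_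
    _ ≤ _ := measure_union_le _ _
    _ ≤ _ := add_le_add h1 h2
    _ = ENNReal.ofReal η := by
      rw [← ENNReal.ofReal_add (by positivity) (by positivity), add_halves]
  intro ω hω
  simp only [Set.mem_ofPred_eq, Set.mem_union] at hω ⊢
  rcases le_total δ ‖X m ω - x₀‖ with h | h
  · exact Or.inr h
  · exact Or.inl ⟨_, h, hω⟩

/-- The delta method: the remainder of a first-order expansion along a consistent sequence with
rate `r` is `o_p(r)`. -/
theorem HasFDerivAt.isLittleOP_remainder [NormedSpace ℝ E] [NormedSpace ℝ F] {f : F → E}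
    {f' : F →L[ℝ] E} {x₀ : F} (hf : HasFDerivAt f f' x₀) (hr : ∀ m, 0 ≤ r m) {X : ℕ → Ω' → F}
    (hX : TendstoInMeasure Pr X atTop fun _ => x₀) (hXr : IsBigOP Pr (fun m ω => X m ω - x₀) r) :
    IsLittleOP Pr (fun m ω => f (X m ω) - f x₀ - f' (X m ω - x₀)) r := by
  rw [tendstoInMeasure_iff_norm] at hX
  intro ε hε
  refine tendsto_zero_of_forall_le_ofReal fun η hη => ?_
  obtain ⟨K, hK⟩ := hXr (η / 2) (by positivity)
  -- `K` may be zero or negative; enlarging it to `|K| + 1` makes `ε / (|K| + 1)` an admissible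
  -- tolerance for the derivative.
  have hK' : 0 < |K| + 1 := by positivity
  obtain ⟨δ, hδ, hball⟩ := Metric.eventually_nhds_iff.1
    (hf.isLittleO.def (show 0 < ε / (|K| + 1) by positivity))
  filter_upwards [hK, eventually_le_ofReal_of_tendsto_zero (hX δ hδ) (half_pos hη)] with m h1 h2
  calc _ ≤ _ := measure_mono (t := _ ∪ _) ?_
    _ ≤ _ := measure_union_le _ _
    _ ≤ _ := add_le_add h1 h2
    _ = ENNReal.ofReal η := by
      rw [← ENNReal.ofReal_add (by positivity) (by positivity), add_halves]
  intro ω hω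
  simp only [Set.mem_ofPred_eq, Set.mem_union] at hω ⊢
  by_contra! hcon
  have h3 := hball (y := X m ω) (by rw [dist_eq_norm]; exact hcon.2)
  rw [div_mul_eq_mul_div, le_div_iff₀ hK'] at h3
  have h4 : ‖X m ω - x₀‖ ≤ (|K| + 1) * r m :=
    hcon.1.trans (mul_le_mul_of_nonneg_right ((le_abs_self K).trans (by linarith)) (hr m))
  have h5 := mul_le_mul_of_nonneg_left h4 hε.le
  have h6 := mul_lt_mul_of_pos_right hω hK'
  linarith

end StochasticOrders

/-! ### One-dimensional central limit theorem for functions on a finite space. -/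

section CentralLimit

variable {Ω' : Type*} [MeasurableSpace Ω'] {Pr : Measure Ω'} [IsProbabilityMeasure Pr]
  {𝒲 : Type*} [Finite 𝒲] [MeasurableSpace 𝒲] [MeasurableSingletonClass 𝒲]
  {ν : Measure 𝒲} [IsProbabilityMeasure ν]

theorem memLp_of_finite (f : 𝒲 → ℝ) (p : ENNReal) : MemLp f p ν := by
  obtain ⟨C, hC⟩ := (Set.finite_range fun w => ‖f w‖).bddAbove
  exact MemLp.of_bound (by fun_prop) C (ae_of_all _ fun w => hC ⟨w, rfl⟩)

theorem tendstoInDistribution_inv_sqrt_mul_sum_comp {W : ℕ → Ω' → 𝒲}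
    (hW : ∀ i, HasLaw (W i) ν Pr) (hind : iIndepFun W Pr) {f : 𝒲 → ℝ} (h0 : ∫ w, f w ∂ν = 0) :
    TendstoInDistribution (fun (n : ℕ) ω => (√(n : ℝ))⁻¹ * ∑ i ∈ Finset.range n, f (W i ω)) atTop
      (id : ℝ → ℝ) (fun _ => Pr) (gaussianReal 0 Var[f; ν].toNNReal) := by
  have hf : Measurable f := by fun_prop
  have hint : Pr[fun ω => f (W 0 ω)] = 0 := by
    rw [← h0]; exact (hW 0).integral_comp hf.aestronglyMeasurable
  have hvar : Var[fun ω => f (W 0 ω); Pr] = Var[f; ν] := by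
    rw [← (hW 0).map_eq, variance_map hf.aemeasurable (hW 0).aemeasurable]; rfl
  have key := tendstoInDistribution_inv_sqrt_mul_sum_sub (P := Pr)
    (P' := gaussianReal 0 Var[f; ν].toNNReal) (X := fun i ω => f (W i ω)) (Y := id)
    (by rw [hvar]; exact HasLaw.id) ?_ ?_ ?_
  · simpa [hint] using key
  · have := memLp_of_finite (ν := ν) f 2
    rw [← (hW 0).map_eq] at this
    exact this.comp_of_map (hW 0).aemeasurable
  · exact hind.comp (fun _ => f) fun _ => hf
  · exact fun i => ((hW i).identDistrib (hW 0)).comp hf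

/-- Slutsky with the deterministic factors `a m`. The argument `1` suffices: the direction in which
the limit is tested will be absorbed into `f`. -/
theorem tendsto_charFun_mul_inv_sqrt_mul_sum {W : ℕ → Ω' → 𝒲}
    (hW : ∀ i, HasLaw (W i) ν Pr) (hind : iIndepFun W Pr) {f : 𝒲 → ℝ} (h0 : ∫ w, f w ∂ν = 0)
    {n : ℕ → ℕ} (hn : Tendsto n atTop atTop) {a : ℕ → ℝ} {c : ℝ} (ha : Tendsto a atTop (𝓝 c)) :
    Tendsto (fun m => charFun (Pr.map fun ω =>
        a m * ((√(n m : ℝ))⁻¹ * ∑ i ∈ Finset.range (n m), f (W i ω))) 1) atTop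
      (𝓝 (Complex.exp (-(c ^ 2 * Var[f; ν] : ℝ) / 2))) := by
  have h1 := tendstoInDistribution_inv_sqrt_mul_sum_comp hW hind h0
  have h2 : TendstoInDistribution
      (fun m ω => (√(n m : ℝ))⁻¹ * ∑ i ∈ Finset.range (n m), f (W i ω)) atTop
      (id : ℝ → ℝ) (fun _ => Pr) (gaussianReal 0 Var[f; ν].toNNReal) :=
    ⟨fun m => h1.forall_aemeasurable (n m), h1.aemeasurable_limit, h1.tendsto.comp hn⟩
  have h3 := h2.continuous_comp_prodMk_of_tendstoInMeasure_const
    (g := fun p : ℝ × ℝ => p.2 * p.1) (by fun_prop) (Y := fun m _ => a m) (c := c)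
    (tendstoInMeasure_of_tendsto_ae (fun _ => by fun_prop) (ae_of_all _ fun _ => ha))
    (fun _ => by fun_prop)
  have h4 := ProbabilityMeasure.tendsto_iff_tendsto_charFun.1 h3.tendsto 1
  convert! h4 using 2
  simp only [ProbabilityMeasure.coe_mk, id]
  rw [charFun_map_mul, charFun_gaussianReal]
  congr 1
  have : ((Var[f; ν].toNNReal : ℝ) : ℂ) = (Var[f; ν] : ℂ) := by
    rw [Real.coe_toNNReal _ (variance_nonneg _ _)]
  simp only [this]
  push_cast
  ring_nf

end CentralLimit

/-! ### Covariance matrices as quadratic forms. -/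

section Covariance

variable {𝒲 : Type*} [Finite 𝒲] [MeasurableSpace 𝒲] [MeasurableSingletonClass 𝒲]
  {ν : Measure 𝒲} [IsProbabilityMeasure ν] {ι : Type*} [Fintype ι]

/-- Bilinearity of covariance. This is the bridge from scalar variances to the covariance matrix in
the Cramér–Wold argument. -/
theorem dotProduct_varMatrix_mulVec (ψ : 𝒲 → ι → ℝ) (c : ι → ℝ) :
    c ⬝ᵥ varMatrix ν ψ *ᵥ c = Var[fun w => c ⬝ᵥ ψ w; ν] := by
  have h : (fun w => c ⬝ᵥ ψ w) = fun w => ∑ i, c i * ψ w i := rfl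
  rw [h, variance_fun_sum fun i => memLp_of_finite _ 2]
  simp only [dotProduct, Matrix.mulVec, varMatrix, Matrix.of_apply, covariance_const_mul_left,
    covariance_const_mul_right, Finset.mul_sum]
  refine Finset.sum_congr rfl fun i _ => Finset.sum_congr rfl fun j _ => by ring

theorem posSemidef_varMatrix (ψ : 𝒲 → ι → ℝ) : (varMatrix ν ψ).PosSemidef := by
  refine Matrix.PosSemidef.of_dotProduct_mulVec_nonneg ?_ fun c => ?_
  · ext i j
    simp [varMatrix, covariance_comm]
  · rw [star_trivial, dotProduct_varMatrix_mulVec]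
    exact variance_nonneg _ _

end Covariance

/-! ### Two-sample multivariate central limit theorem. -/

section TwoSample

variable {Ω' : Type*} [MeasurableSpace Ω'] {Pr : Measure Ω'} [IsProbabilityMeasure Pr]
  {𝒲 : Type*} [Finite 𝒲] [MeasurableSpace 𝒲] [MeasurableSingletonClass 𝒲]
  {ν₁ ν₂ : Measure 𝒲} [IsProbabilityMeasure ν₁] [IsProbabilityMeasure ν₂]
  {ι : Type*} [Fintype ι] [DecidableEq ι]

omit [IsProbabilityMeasure Pr] in
/-- Sums over two jointly independent samples are independent. -/
theorem indepFun_sum_sum {W₁ W₂ : ℕ → Ω' → 𝒲} (hm₁ : ∀ i, AEMeasurable (W₁ i) Pr)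
    (hm₂ : ∀ i, AEMeasurable (W₂ i) Pr)
    (hindep : iIndepFun (fun k : ℕ ⊕ ℕ => Sum.elim W₁ W₂ k) Pr) (f₁ f₂ : 𝒲 → ℝ) (n₁ n₂ : ℕ) :
    IndepFun (fun ω => ∑ i ∈ Finset.range n₁, f₁ (W₁ i ω))
      (fun ω => ∑ i ∈ Finset.range n₂, f₂ (W₂ i ω)) Pr := by
  have hmeas : ∀ k : ℕ ⊕ ℕ, AEMeasurable (Sum.elim W₁ W₂ k) Pr := by
    rintro (i | i)
    exacts [hm₁ i, hm₂ i]
  -- The two samples are disjoint index blocks of one independent family over `ℕ ⊕ ℕ`.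
  have hdisj : Disjoint ((Finset.range n₁).map (Function.Embedding.inl : ℕ ↪ ℕ ⊕ ℕ))
      ((Finset.range n₂).map Function.Embedding.inr) := by
    simp [Finset.disjoint_left]
  have h := hindep.indepFun_finset₀ _ _ hdisj hmeas
  have hf₁ : Measurable f₁ := .of_discrete
  have hf₂ : Measurable f₂ := .of_discrete
  have h' := h.comp
    (φ := fun w => ∑ i : Finset.range n₁, f₁ (w ⟨Sum.inl i.1, Finset.mem_map_of_mem Function.Embedding.inl i.2⟩))
    (ψ := fun w => ∑ i : Finset.range n₂, f₂ (w ⟨Sum.inr i.1, Finset.mem_map_of_mem Function.Embedding.inr i.2⟩))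
    (by fun_prop) (by fun_prop)
  convert! h' using 1
  · ext ω
    exact (Finset.sum_coe_sort (Finset.range n₁) fun i => f₁ (W₁ i ω)).symm
  · ext ω
    exact (Finset.sum_coe_sort (Finset.range n₂) fun i => f₂ (W₂ i ω)).symm

/-- The two-sample multivariate central limit theorem, for a linear image of the sum of the two
sample means, at the scale of the second sample. -/
theorem tendstoInDistribution_two_sample {W₁ W₂ : ℕ → Ω' → 𝒲} (hW₁ : ∀ i, HasLaw (W₁ i) ν₁ Pr)
    (hW₂ : ∀ i, HasLaw (W₂ i) ν₂ Pr)
    (hindep : iIndepFun (fun k : ℕ ⊕ ℕ => Sum.elim W₁ W₂ k) Pr)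
    {n₁ n₂ : ℕ → ℕ} (hn₁ : Tendsto n₁ atTop atTop) (hn₂ : Tendsto n₂ atTop atTop)
    {lam : ℝ} (hlam : 0 ≤ lam)
    (hratio : Tendsto (fun m => (n₂ m : ℝ) / (n₁ m : ℝ)) atTop (𝓝 lam))
    {ψ₁ ψ₂ : 𝒲 → ι → ℝ} (h₁ : ∀ x, ∫ w, ψ₁ w x ∂ν₁ = 0) (h₂ : ∀ x, ∫ w, ψ₂ w x ∂ν₂ = 0)
    (B : Matrix ι ι ℝ) :
    TendstoInDistribution
      (fun m ω => WithLp.toLp 2 (√(n₂ m : ℝ) • (B *ᵥ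
        ((n₁ m : ℝ)⁻¹ • ∑ i ∈ Finset.range (n₁ m), ψ₁ (W₁ i ω)
          + (n₂ m : ℝ)⁻¹ • ∑ i ∈ Finset.range (n₂ m), ψ₂ (W₂ i ω))))) atTop
      (id : EuclideanSpace ℝ ι → EuclideanSpace ℝ ι) (fun _ => Pr)
      (multivariateGaussian 0 (B * (lam • varMatrix ν₁ ψ₁ + varMatrix ν₂ ψ₂) * Bᵀ)) := by
  have hm₁ := fun i => (hW₁ i).aemeasurable
  have hm₂ := fun i => (hW₂ i).aemeasurable
  have hψ₁ : ∀ i, AEMeasurable (fun ω => ψ₁ (W₁ i ω)) Pr := fun i =>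
    (Measurable.of_discrete (f := ψ₁)).comp_aemeasurable (hm₁ i)
  have hψ₂ : ∀ i, AEMeasurable (fun ω => ψ₂ (W₂ i ω)) Pr := fun i =>
    (Measurable.of_discrete (f := ψ₂)).comp_aemeasurable (hm₂ i)
  have hB : Continuous fun v : ι → ℝ => WithLp.toLp 2 (B *ᵥ v) := by fun_prop
  have hmeas : ∀ m, AEMeasurable (fun ω => WithLp.toLp 2 (√(n₂ m : ℝ) • (B *ᵥ
        ((n₁ m : ℝ)⁻¹ • ∑ i ∈ Finset.range (n₁ m), ψ₁ (W₁ i ω)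
          + (n₂ m : ℝ)⁻¹ • ∑ i ∈ Finset.range (n₂ m), ψ₂ (W₂ i ω))))) Pr := by
    intro m
    have hs : AEMeasurable (fun ω => (n₁ m : ℝ)⁻¹ • ∑ i ∈ Finset.range (n₁ m), ψ₁ (W₁ i ω)
          + (n₂ m : ℝ)⁻¹ • ∑ i ∈ Finset.range (n₂ m), ψ₂ (W₂ i ω)) Pr := by
      have hs₁ := Finset.aemeasurable_fun_sum (Finset.range (n₁ m)) fun i _ => hψ₁ i
      have hs₂ := Finset.aemeasurable_fun_sum (Finset.range (n₂ m)) fun i _ => hψ₂ i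
      exact (hs₁.const_smul (n₁ m : ℝ)⁻¹).add (hs₂.const_smul (n₂ m : ℝ)⁻¹)
    exact (hB.measurable.comp_aemeasurable hs).const_smul (√(n₂ m : ℝ))
  refine ⟨hmeas, aemeasurable_id, ?_⟩
  refine ProbabilityMeasure.tendsto_iff_tendsto_charFun.2 fun t => ?_
  -- The Gaussian characteristic function formula below requires a positive semidefinite covariance.
  have hpsd : (B * (lam • varMatrix ν₁ ψ₁ + varMatrix ν₂ ψ₂) * Bᵀ).PosSemidef := by
    have := (((posSemidef_varMatrix (ν := ν₁) ψ₁).smul hlam).add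
      (posSemidef_varMatrix (ν := ν₂) ψ₂)).mul_mul_conjTranspose_same B
    simpa using this
  -- Since `⟪B v, t⟫ = c ⬝ᵥ v`, testing in direction `t` reduces to the scalar functions `f₁`, `f₂`.
  set c : ι → ℝ := Bᵀ *ᵥ (t : ι → ℝ) with hc
  set f₁ : 𝒲 → ℝ := fun w => c ⬝ᵥ ψ₁ w with hf₁
  set f₂ : 𝒲 → ℝ := fun w => c ⬝ᵥ ψ₂ w with hf₂
  have hi : ∀ {ν : Measure 𝒲} [IsProbabilityMeasure ν] {ψ : 𝒲 → ι → ℝ},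
      (∀ x, ∫ w, ψ w x ∂ν = 0) → ∫ w, c ⬝ᵥ ψ w ∂ν = 0 := by
    intro ν _ ψ h
    simp only [dotProduct]
    rw [integral_finsetSum _ fun i _ => (memLp_one_iff_integrable.1 (memLp_of_finite _ 1))]
    simp [integral_const_mul, h]
  have hind₁ : iIndepFun W₁ Pr := hindep.precomp (g := Sum.inl) Sum.inl_injective
  have hind₂ : iIndepFun W₂ Pr := hindep.precomp (g := Sum.inr) Sum.inr_injective
  have hsq : Tendsto (fun m => √((n₂ m : ℝ) / (n₁ m : ℝ))) atTop (𝓝 (√lam)) := hratio.sqrt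
  have hlim := (tendsto_charFun_mul_inv_sqrt_mul_sum hW₁ hind₁ (f := f₁) (hi h₁) hn₁ hsq).mul
    (tendsto_charFun_mul_inv_sqrt_mul_sum hW₂ hind₂ (f := f₂) (hi h₂) hn₂
      (tendsto_const_nhds (x := (1 : ℝ))))
  convert! hlim using 1
  · ext m
    have hsum₁ : AEMeasurable (fun ω => ∑ i ∈ Finset.range (n₁ m), f₁ (W₁ i ω)) Pr :=
      Finset.aemeasurable_fun_sum _ fun i _ =>
        (Measurable.of_discrete (f := f₁)).comp_aemeasurable (hm₁ i)
    have hsum₂ : AEMeasurable (fun ω => ∑ i ∈ Finset.range (n₂ m), f₂ (W₂ i ω)) Pr :=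
      Finset.aemeasurable_fun_sum _ fun i _ =>
        (Measurable.of_discrete (f := f₂)).comp_aemeasurable (hm₂ i)
    have hI := (indepFun_sum_sum hm₁ hm₂ hindep f₁ f₂ (n₁ m) (n₂ m)).comp
      (φ := fun x => √((n₂ m : ℝ) / (n₁ m : ℝ)) * ((√(n₁ m : ℝ))⁻¹ * x))
      (ψ := fun x => 1 * ((√(n₂ m : ℝ))⁻¹ * x)) (by fun_prop) (by fun_prop)
    have hmul := hI.charFun_map_fun_add_eq_mul (by fun_prop) (by fun_prop)
    have hmul1 := congrFun hmul 1
    simp only [Pi.mul_apply, Function.comp_def] at hmul1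
    rw [← hmul1, charFun_apply, charFun_apply]
    simp only [ProbabilityMeasure.coe_mk]
    rw [integral_map (hmeas m) (by fun_prop), integral_map (by fun_prop) (by fun_prop)]
    congr 1
    ext ω
    congr 3
    have key : ∀ v : ι → ℝ, inner ℝ (WithLp.toLp 2 (B *ᵥ v)) t = c ⬝ᵥ v := by
      intro v
      rw [EuclideanSpace.inner_eq_star_dotProduct]
      simp only [star_trivial, hc]
      rw [Matrix.mulVec_transpose, ← Matrix.dotProduct_mulVec]
    rw [WithLp.toLp_smul, real_inner_smul_left, key]
    -- Both scaling identities also hold for empty samples, where the inverses are `0`.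
    have hs : ∀ n : ℕ, (√(n : ℝ))⁻¹ = √(n : ℝ) * (n : ℝ)⁻¹ := by
      intro n
      rw [← div_eq_mul_inv, Real.sqrt_div_self]
    have hs' : ∀ k n : ℕ, √(k : ℝ) / √(n : ℝ) * (√(n : ℝ))⁻¹ = √(k : ℝ) * (n : ℝ)⁻¹ := by
      intro k n
      rw [div_eq_mul_inv, mul_assoc, ← mul_inv, Real.mul_self_sqrt (Nat.cast_nonneg n)]
    simp only [dotProduct_add, dotProduct_smul, dotProduct_sum, smul_eq_mul, hf₁, hf₂, mul_add,
      one_mul, Real.sqrt_div (Nat.cast_nonneg (n₂ m)), RCLike.inner_apply, conj_trivial]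
    rw [← mul_assoc (_ / _), hs', hs (n₂ m), mul_assoc, mul_assoc]
  · congr 1
    rw [← Complex.exp_add]
    simp only [ProbabilityMeasure.coe_mk, Measure.map_id]
    rw [charFun_multivariateGaussian hpsd]
    congr 1
    have hq : (t : ι → ℝ) ⬝ᵥ (B * (lam • varMatrix ν₁ ψ₁ + varMatrix ν₂ ψ₂) * Bᵀ) *ᵥ (t : ι → ℝ)
        = lam * Var[f₁; ν₁] + Var[f₂; ν₂] := by
      rw [← Matrix.mulVec_mulVec, ← Matrix.mulVec_mulVec, Matrix.dotProduct_mulVec,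
        ← Matrix.mulVec_transpose, ← hc, Matrix.add_mulVec, dotProduct_add, Matrix.smul_mulVec,
        dotProduct_smul, dotProduct_varMatrix_mulVec, dotProduct_varMatrix_mulVec, smul_eq_mul]
    rw [hq, Real.sq_sqrt hlam]
    simp
    ring

end TwoSample

/-! ### Sup-norm contractions and invertibility. -/

section Contractions

variable {ι κ : Type*} [Fintype ι] [Fintype κ]

/-- Row sums are only bounded by `1`, which admits the zero rows of an empirical kernel at unvisited
pairs. -/
theorem norm_mulVec_le_of_substochastic {A : Matrix ι κ ℝ} (h0 : ∀ i j, 0 ≤ A i j)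
    (h1 : ∀ i, ∑ j, A i j ≤ 1) (v : κ → ℝ) : ‖A *ᵥ v‖ ≤ ‖v‖ := by
  refine (pi_norm_le_iff_of_nonneg (norm_nonneg v)).2 fun i => ?_
  calc ‖(A *ᵥ v) i‖ ≤ ∑ j, ‖A i j * v j‖ := norm_sum_le _ _
    _ ≤ ∑ j, A i j * ‖v‖ := Finset.sum_le_sum fun j _ => by
      rw [norm_mul, Real.norm_of_nonneg (h0 i j)]
      exact mul_le_mul_of_nonneg_left (norm_le_pi_norm v j) (h0 i j)
    _ = (∑ j, A i j) * ‖v‖ := (Finset.sum_mul ..).symm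
    _ ≤ ‖v‖ := mul_le_of_le_one_left (norm_nonneg v) (h1 i)

/-- A vector in the kernel of `1 - A` is fixed by a strict contraction, hence zero; in finite
dimension injectivity is invertibility. -/
theorem isUnit_one_sub_of_norm_mulVec_le [DecidableEq ι] {A : Matrix ι ι ℝ} {c : ℝ} (hc : c < 1)
    (h : ∀ v, ‖A *ᵥ v‖ ≤ c * ‖v‖) : IsUnit (1 - A) := by
  rw [← Matrix.mulVec_injective_iff_isUnit]
  intro v w hvw
  have hz : v - w = A *ᵥ (v - w) := by
    simp only [Matrix.sub_mulVec, Matrix.one_mulVec] at hvw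
    rw [Matrix.mulVec_sub, sub_eq_sub_iff_sub_eq_sub]
    exact hvw
  have h' := h (v - w)
  rw [← hz] at h'
  have : ‖v - w‖ = 0 := by nlinarith [norm_nonneg (v - w)]
  exact sub_eq_zero.1 (norm_eq_zero.1 this)

end Contractions

/-! ### Nonexpansiveness of policy and transition operators. -/

section TransitionOperators

variable {S A : Type*} [Fintype S] [DecidableEq S] [Fintype A]

theorem sum_toReal_pmf {α : Type*} [Fintype α] (p : PMF α) : ∑ a, (p a).toReal = 1 := by
  rw [← ENNReal.toReal_sum fun a _ => p.apply_ne_top a, ← tsum_fintype (L := .unconditional _),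
    p.tsum_coe, ENNReal.toReal_one]

theorem norm_policyMatrix_mulVec_le (π : S → PMF A) (v : S × A → ℝ) :
    ‖policyMatrix π *ᵥ v‖ ≤ ‖v‖ := by
  refine norm_mulVec_le_of_substochastic (fun s y => ?_) (fun s => ?_) v
  · simp only [policyMatrix, Matrix.of_apply]
    split_ifs <;> simp
  · simp [policyMatrix, Fintype.sum_prod_type, sum_toReal_pmf]

omit [DecidableEq S] in
theorem norm_kernelMatrix_mulVec_le (P : S × A → PMF S) (v : S → ℝ) :
    ‖kernelMatrix P *ᵥ v‖ ≤ ‖v‖ :=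
  norm_mulVec_le_of_substochastic (fun _ _ => ENNReal.toReal_nonneg)
    (fun x => (sum_toReal_pmf (P x)).le) v

theorem norm_empiricalKernel_mulVec_le [DecidableEq A] (W : ℕ → (S × A) × S) (n : ℕ) (v : S → ℝ) :
    ‖empiricalKernel W n *ᵥ v‖ ≤ ‖v‖ := by
  refine norm_mulVec_le_of_substochastic (fun x s => ?_) (fun x => ?_) v
  · simp only [empiricalKernel, Matrix.of_apply]
    positivity
  · simp only [empiricalKernel, Matrix.of_apply]
    rw [← Finset.sum_div, ← Nat.cast_sum]
    -- Counts over successor states add up to the visit count; an unvisited pair gives `0 / 0 = 0`.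
    refine div_le_one_of_le₀ (Nat.cast_le.2 (le_of_eq ?_)) (Nat.cast_nonneg _)
    rw [Finset.card_eq_sum_card_fiberwise (f := fun i => (W i).2) (t := Finset.univ) (by simp)]
    refine Finset.sum_congr rfl fun s _ => ?_
    rw [Finset.filter_filter]
    simp [Prod.ext_iff]

end TransitionOperators

/-! ### Regularity of the soft value operator. -/

section SoftValue

variable {S A : Type*} [Fintype S] [Fintype A]

theorem sum_mul_exp_pos {p : PMF A} (hp : ∀ a, 0 < p a) (f : A → ℝ) :
    0 < ∑ a, (p a).toReal * Real.exp (f a) := by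
  -- The existence of a probability on `A` is what makes the sum nonempty.
  obtain ⟨a, -⟩ := p.support_nonempty
  exact Finset.sum_pos (fun a _ => mul_pos (ENNReal.toReal_pos (hp a).ne' (p.apply_ne_top a))
    (Real.exp_pos _)) ⟨a, Finset.mem_univ a⟩

/-- Raising `q'` by the constant `‖q - q'‖` dominates `q`, and log-sum-exp is monotone and commutes
with adding constants. -/
theorem softValue_le_add_norm {τ : ℝ} (hτ : 0 < τ) {π : S → PMF A} (hπ : ∀ s a, 0 < π s a)
    (q q' : S × A → ℝ) (s : S) : softValue τ π q s ≤ softValue τ π q' s + ‖q - q'‖ := by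
  have hpos := fun q : S × A → ℝ => sum_mul_exp_pos (hπ s) fun a => q (s, a) / τ
  have hle : ∑ a, (π s a).toReal * Real.exp (q (s, a) / τ)
      ≤ Real.exp (‖q - q'‖ / τ) * ∑ a, (π s a).toReal * Real.exp (q' (s, a) / τ) := by
    rw [Finset.mul_sum]
    refine Finset.sum_le_sum fun a _ => ?_
    rw [mul_left_comm, ← Real.exp_add, ← add_div]
    gcongr
    have := (le_abs_self _).trans (norm_le_pi_norm (q - q') (s, a))
    rw [Pi.sub_apply] at this
    linarith
  have hlog := Real.log_le_log (hpos q) hle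
  rw [Real.log_mul (Real.exp_pos _).ne' (hpos q').ne', Real.log_exp] at hlog
  have := mul_le_mul_of_nonneg_left hlog hτ.le
  rw [mul_add, mul_div_cancel₀ _ hτ.ne'] at this
  simp only [softValue]
  linarith

theorem lipschitzWith_softValue {τ : ℝ} (hτ : 0 < τ) {π : S → PMF A} (hπ : ∀ s a, 0 < π s a) :
    LipschitzWith 1 (softValue τ π) := by
  refine LipschitzWith.of_dist_le_mul fun q q' => ?_
  rw [dist_eq_norm, dist_eq_norm, NNReal.coe_one, one_mul]
  refine (pi_norm_le_iff_of_nonneg (norm_nonneg _)).2 fun s => ?_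
  rw [Pi.sub_apply, Real.norm_eq_abs, abs_sub_le_iff]
  have h1 := softValue_le_add_norm hτ hπ q q' s
  have h2 := softValue_le_add_norm hτ hπ q' q s
  rw [norm_sub_rev] at h2
  constructor <;> linarith

theorem differentiable_softValue {τ : ℝ} {π : S → PMF A} (hπ : ∀ s a, 0 < π s a) :
    Differentiable ℝ (softValue τ π) := by
  refine differentiable_pi.2 fun s => ?_
  refine Differentiable.const_mul (Differentiable.log (by fun_prop) fun q => ?_) _
  exact (sum_mul_exp_pos (hπ s) fun a => q (s, a) / τ).ne'

end SoftValue

/-! ### Resolvents and exact perturbation identities. -/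

namespace TransferModel

variable {S A : Type*} [Fintype S] [DecidableEq S] [Fintype A] [DecidableEq A]
  (M : TransferModel S A)

/-- Applies to the true and to every empirical kernel, so the resolvent identities hold at every
sample point, with no exceptional event. -/
theorem isUnit_one_sub_anchored {P : Matrix (S × A) S ℝ} (hP : ∀ v, ‖P *ᵥ v‖ ≤ ‖v‖) :
    IsUnit (1 - M.γ₁ • M.anchored P) := by
  refine isUnit_one_sub_of_norm_mulVec_le M.γ₁_mem.2 fun v => ?_
  rw [Matrix.smul_mulVec, norm_smul, Real.norm_of_nonneg M.γ₁_mem.1.le, anchored,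
    ← Matrix.mulVec_mulVec]
  exact mul_le_mul_of_nonneg_left ((hP _).trans (norm_policyMatrix_mulVec_le _ _)) M.γ₁_mem.1.le

theorem P₂pi_mulVec (q v : S × A → ℝ) :
    M.P₂pi q *ᵥ v = kernelMatrix M.P₂ *ᵥ fderiv ℝ M.Ω q v := by
  rw [P₂pi, ← Matrix.mulVec_mulVec, LinearMap.toMatrix'_mulVec]
  rfl

theorem isUnit_one_sub_P₂pi (q : S × A → ℝ) : IsUnit (1 - M.γ₂ • M.P₂pi q) := by
  refine isUnit_one_sub_of_norm_mulVec_le M.γ₂_mem.2 fun v => ?_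
  rw [Matrix.smul_mulVec, norm_smul, Real.norm_of_nonneg M.γ₂_mem.1.le, P₂pi_mulVec]
  -- A derivative is bounded by the Lipschitz constant, so `γ₂ P₂ DΩ` contracts by `γ₂`.
  have hΩ : ‖fderiv ℝ M.Ω q‖ ≤ 1 := by
    exact norm_fderiv_le_of_lipschitz ℝ (lipschitzWith_softValue M.τ₂_pos M.πref₂_pos)
  refine mul_le_mul_of_nonneg_left ((norm_kernelMatrix_mulVec_le _ _).trans ?_) M.γ₂_mem.1.le
  simpa using (fderiv ℝ M.Ω q).le_of_opNorm_le hΩ v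

/-- The soft Bellman residual `q ↦ γ₂ P₂ Ω(q) - q` has derivative `-(I - γ₂ P₂^π)`. -/
theorem hasFDerivAt_softBellman (q : S × A → ℝ) :
    HasFDerivAt (fun q => M.γ₂ • (kernelMatrix M.P₂ *ᵥ M.Ω q) - q)
      (-(Matrix.mulVecLin (1 - M.γ₂ • M.P₂pi q)).toContinuousLinearMap) q := by
  have hΩ : HasFDerivAt M.Ω (fderiv ℝ M.Ω q) q :=
    (differentiable_softValue M.πref₂_pos q).hasFDerivAt
  have h := (((Matrix.mulVecLin (kernelMatrix M.P₂)).toContinuousLinearMap.hasFDerivAt.comp q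
    hΩ).const_smul M.γ₂).sub (hasFDerivAt_id q)
  convert! h using 1
  ext1 v
  simp [P₂pi_mulVec]

theorem resolvent_mulVec (P : Matrix (S × A) S ℝ) (v : S × A → ℝ) :
    M.resolvent P *ᵥ v
      = (1 - anchorMatrix M.μ) *ᵥ ((1 - M.γ₁ • M.anchored P)⁻¹ *ᵥ v) := by
  rw [resolvent, Matrix.mulVec_mulVec]

/-- With `u_g = (I - γ₁ P₁^μ) q₁⋆`, one has `u_g - (I - γ₁ P^μ) q₁⋆ = γ₁ (P^μ - P₁^μ) q₁⋆`; apply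
the resolvent of `P`. The identity is exact, with no second-order remainder. -/
theorem resolvent_mulVec_ug_sub {P : Matrix (S × A) S ℝ} (hP : ∀ v, ‖P *ᵥ v‖ ≤ ‖v‖) :
    M.resolvent P *ᵥ M.ug - (1 - anchorMatrix M.μ) *ᵥ M.q₁star
      = M.γ₁ • (M.resolvent P *ᵥ
        ((M.anchored P - M.anchored (kernelMatrix M.P₁)) *ᵥ M.q₁star)) := by
  have h1 := (Matrix.isUnit_iff_isUnit_det _).1 (M.isUnit_one_sub_anchored hP)
  have h2 := (Matrix.isUnit_iff_isUnit_det _).1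
    (M.isUnit_one_sub_anchored (norm_kernelMatrix_mulVec_le M.P₁))
  have hug : M.ug = (1 - M.γ₁ • M.anchored (kernelMatrix M.P₁)) *ᵥ M.q₁star := by
    rw [q₁star, Matrix.mulVec_mulVec, Matrix.mul_nonsing_inv _ h2, Matrix.one_mulVec]
  have hq : M.q₁star = (1 - M.γ₁ • M.anchored P)⁻¹ *ᵥ
      ((1 - M.γ₁ • M.anchored P) *ᵥ M.q₁star) := by
    rw [Matrix.mulVec_mulVec, Matrix.nonsing_inv_mul _ h1, Matrix.one_mulVec]
  rw [resolvent_mulVec, resolvent_mulVec, ← Matrix.mulVec_sub, ← Matrix.mulVec_smul,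
    ← Matrix.mulVec_smul]
  congr 1
  nth_rw 1 [hq]
  rw [hug, ← Matrix.mulVec_sub]
  congr 1
  simp only [Matrix.sub_mulVec, Matrix.smul_mulVec, smul_sub]
  abel

/-- The residual is `u_g - (I - γ₁ P^μ) q`, so the inverse undoes the action on `q`. This turns the
modular first-stage residual into an error of `(I - Π_μ) q`. -/
theorem resolvent_mulVec_b₁ {P : Matrix (S × A) S ℝ} (hP : ∀ v, ‖P *ᵥ v‖ ≤ ‖v‖)
    (q : S × A → ℝ) :
    M.resolvent P *ᵥ M.b₁ P q = M.resolvent P *ᵥ M.ug - (1 - anchorMatrix M.μ) *ᵥ q := by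
  have h1 := (Matrix.isUnit_iff_isUnit_det _).1 (M.isUnit_one_sub_anchored hP)
  have hb : M.b₁ P q = M.ug - (1 - M.γ₁ • M.anchored P) *ᵥ q := by
    rw [b₁, Matrix.sub_mulVec, Matrix.one_mulVec, Matrix.smul_mulVec]
    abel
  rw [hb, Matrix.mulVec_sub, resolvent_mulVec _ _ ((1 - _) *ᵥ q), Matrix.mulVec_mulVec q,
    Matrix.nonsing_inv_mul _ h1, Matrix.one_mulVec]

end TransferModel

theorem MeasureTheory.TendstoInMeasure.prodMk_norm {Ω' : Type*} [MeasurableSpace Ω']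
    {Pr : Measure Ω'} {E F : Type*} [NormedAddCommGroup E] [NormedAddCommGroup F]
    {X : ℕ → Ω' → E} {Y : ℕ → Ω' → F} {x : Ω' → E} {y : Ω' → F}
    (hX : TendstoInMeasure Pr X atTop x) (hY : TendstoInMeasure Pr Y atTop y) :
    TendstoInMeasure Pr (fun m ω => (X m ω, Y m ω)) atTop fun ω => (x ω, y ω) := by
  rw [tendstoInMeasure_iff_norm] at hX hY ⊢
  intro ε hε
  have h := (hX ε hε).add (hY ε hε)
  rw [add_zero] at h
  refine tendsto_of_tendsto_of_tendsto_of_le_of_le tendsto_const_nhds h (fun _ => zero_le) ?_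
  intro m
  refine (measure_mono ?_).trans (measure_union_le _ _)
  intro ω hω
  simpa [Prod.norm_def, le_max_iff] using hω

theorem IsAsymptoticallyLinear.sub {Ω' : Type*} [MeasurableSpace Ω'] {Pr : Measure Ω'}
    {𝒲 ι : Type*} [Finite 𝒲] [MeasurableSpace 𝒲] [MeasurableSingletonClass 𝒲] [Fintype ι]
    {ν : Measure 𝒲} [IsProbabilityMeasure ν] {W : ℕ → Ω' → 𝒲} {n : ℕ → ℕ}
    {X Y : ℕ → Ω' → ι → ℝ} {ψ φ : 𝒲 → ι → ℝ} (hX : IsAsymptoticallyLinear Pr ν W n X ψ)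
    (hY : IsAsymptoticallyLinear Pr ν W n Y φ) :
    IsAsymptoticallyLinear Pr ν W n (fun m ω => X m ω - Y m ω) fun w => ψ w - φ w := by
  refine ⟨fun x => ?_, ?_⟩
  · simp only [Pi.sub_apply]
    rw [integral_sub (memLp_one_iff_integrable.1 (memLp_of_finite _ 1))
      (memLp_one_iff_integrable.1 (memLp_of_finite _ 1)), hX.1, hY.1, sub_zero]
  · convert! hX.2.sub hY.2 using 3 with m ω
    rw [Finset.sum_sub_distrib, smul_sub]
    exact sub_sub_sub_comm _ _ _ _

/-! ### From linearization to asymptotic normality. -/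

section AsymptoticNormality

variable {Ω' : Type*} [MeasurableSpace Ω'] {Pr : Measure Ω'} [IsProbabilityMeasure Pr]
  {𝒲 : Type*} [Finite 𝒲] [MeasurableSpace 𝒲] [MeasurableSingletonClass 𝒲]
  {ν₁ ν₂ : Measure 𝒲} [IsProbabilityMeasure ν₁] [IsProbabilityMeasure ν₂]
  {ι : Type*} [Fintype ι] [DecidableEq ι]

/-- Asymptotic normality of an estimator `X` of `x₀` for which `L (X - x₀)` is, up to `o_p(r)`, a
sum of two independent asymptotically linear terms. -/
theorem tendstoInDistribution_of_linearized {W₁ W₂ : ℕ → Ω' → 𝒲}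
    (hW₁ : ∀ i, HasLaw (W₁ i) ν₁ Pr) (hW₂ : ∀ i, HasLaw (W₂ i) ν₂ Pr)
    (hindep : iIndepFun (fun k : ℕ ⊕ ℕ => Sum.elim W₁ W₂ k) Pr)
    {n₁ n₂ : ℕ → ℕ} (hn₁ : Tendsto n₁ atTop atTop) (hn₂ : Tendsto n₂ atTop atTop)
    {lam : ℝ} (hlam : 0 ≤ lam)
    (hratio : Tendsto (fun m => (n₂ m : ℝ) / (n₁ m : ℝ)) atTop (𝓝 lam))
    {rate : ℕ → ℝ} (hrate : ∀ m, rate m = (√(n₁ m : ℝ))⁻¹ + (√(n₂ m : ℝ))⁻¹)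
    {ψ₁ ψ₂ : 𝒲 → ι → ℝ} {Y₁ Y₂ X : ℕ → Ω' → ι → ℝ} {x₀ : ι → ℝ}
    (h₁ : IsAsymptoticallyLinear Pr ν₁ W₁ n₁ Y₁ ψ₁)
    (h₂ : IsAsymptoticallyLinear Pr ν₂ W₂ n₂ Y₂ ψ₂)
    {L : Matrix ι ι ℝ} (hL : IsUnit L) (hX : ∀ m, AEMeasurable (X m) Pr)
    (hlin : IsLittleOP Pr (fun m ω => L *ᵥ (X m ω - x₀) - (Y₁ m ω + Y₂ m ω)) rate) :
    TendstoInDistribution (fun m ω => WithLp.toLp 2 (√(n₂ m : ℝ) • (X m ω - x₀))) atTop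
      (id : EuclideanSpace ℝ ι → EuclideanSpace ℝ ι) (fun _ => Pr)
      (multivariateGaussian 0
        (L⁻¹ * (lam • varMatrix ν₁ ψ₁ + varMatrix ν₂ ψ₂) * (L⁻¹)ᵀ)) := by
  have hLdet := (Matrix.isUnit_iff_isUnit_det _).1 hL
  have hr₁ : ∀ m, (√(n₁ m : ℝ))⁻¹ ≤ rate m := fun m => by
    rw [hrate]; exact le_add_of_nonneg_right (by positivity)
  have hr₂ : ∀ m, (√(n₂ m : ℝ))⁻¹ ≤ rate m := fun m => by
    rw [hrate]; exact le_add_of_nonneg_left (by positivity)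
  let T : (ι → ℝ) →L[ℝ] EuclideanSpace ℝ ι :=
    (PiLp.continuousLinearEquiv 2 ℝ fun _ : ι => ℝ).symm.toContinuousLinearMap.comp
      (Matrix.mulVecLin L⁻¹).toContinuousLinearMap
  have hT : ∀ v, T v = WithLp.toLp 2 (L⁻¹ *ᵥ v) := fun v => rfl
  have hrem := ((hlin.add (h₁.2.mono_rate hr₁)).add (h₂.2.mono_rate hr₂)).clm_comp T
  -- `√n₂ · r = √(n₂ / n₁) + √n₂ (√n₂)⁻¹`: eventually the first term is below `√λ + 1`, and the
  -- second is at most `1` even when `n₂ m = 0`.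
  have hbound : ∀ᶠ m in atTop, √(n₂ m : ℝ) * rate m < √lam + 1 + 1 := by
    filter_upwards [hratio.sqrt.eventually_lt_const (lt_add_one (√lam))] with m hm
    rw [Real.sqrt_div (Nat.cast_nonneg _), div_eq_mul_inv] at hm
    have : √(n₂ m : ℝ) * (√(n₂ m : ℝ))⁻¹ ≤ 1 := mul_inv_le_one
    rw [hrate, mul_add]
    linarith
  refine tendstoInDistribution_of_tendstoInMeasure_sub _ _
    (tendstoInDistribution_two_sample hW₁ hW₂ hindep hn₁ hn₂ hlam hratio h₁.1 h₂.1 L⁻¹) ?_ ?_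
  · convert! hrem.tendstoInMeasure_smul (fun m => Real.sqrt_nonneg (n₂ m : ℝ)) hbound using 1
    ext1 m
    ext1 ω
    simp only [hT, Pi.sub_apply]
    rw [← WithLp.toLp_sub, ← WithLp.toLp_smul, ← smul_sub]
    congr 2
    have hinv : X m ω - x₀ = L⁻¹ *ᵥ (L *ᵥ (X m ω - x₀)) := by
      rw [Matrix.mulVec_mulVec, Matrix.nonsing_inv_mul _ hLdet, Matrix.one_mulVec]
    nth_rw 1 [hinv]
    rw [← Matrix.mulVec_sub]
    congr 1
    abel
  · intro m
    have hc : Continuous fun v : ι → ℝ => WithLp.toLp 2 (√(n₂ m : ℝ) • (v - x₀)) := by fun_prop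
    exact hc.measurable.comp_aemeasurable (hX m)

end AsymptoticNormality

/-! ### The comparison theorem. -/

theorem mainTheorem11 {S A : Type*}
    [Fintype S] [DecidableEq S] [MeasurableSpace S] [MeasurableSingletonClass S]
    [Fintype A] [DecidableEq A] [MeasurableSpace A] [MeasurableSingletonClass A]
    (M : TransferModel S A) (β : ℝ) (hβ : 0 ≤ β) (Q₁ Q₂ L₁ L₂ : Set (S × A → ℝ))
    -- the target value `q₂⋆`
    (q₂star : S × A → ℝ) (hq₂star : M.b₂ (kernelMatrix M.P₂) M.q₁star q₂star = 0)
    -- two independent i.i.d. samples of transitions, of sizes `n₁ m` and `n₂ m`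
    {Ω' : Type*} [MeasurableSpace Ω'] (Pr : Measure Ω') [IsProbabilityMeasure Pr]
    (W₁ W₂ : ℕ → Ω' → (S × A) × S)
    (hW₁ : ∀ i, HasLaw (W₁ i) (transitionLaw M.ρ₁ M.P₁).toMeasure Pr)
    (hW₂ : ∀ i, HasLaw (W₂ i) (transitionLaw M.ρ₂ M.P₂).toMeasure Pr)
    (hindep : iIndepFun (fun k : ℕ ⊕ ℕ => Sum.elim W₁ W₂ k) Pr)
    (n₁ n₂ : ℕ → ℕ) (hn₁ : Tendsto n₁ atTop atTop) (hn₂ : Tendsto n₂ atTop atTop)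
    (lam : ℝ) (hlam : 0 < lam)
    (hratio : Tendsto (fun m => (n₂ m : ℝ) / (n₁ m : ℝ)) atTop (𝓝 lam))
    -- the empirical transition operators
    (Phat₁ Phat₂ : ℕ → Ω' → Matrix (S × A) S ℝ)
    (hPhat₁ : ∀ m ω, Phat₁ m ω = empiricalKernel (fun i => W₁ i ω) (n₁ m))
    (hPhat₂ : ∀ m ω, Phat₂ m ω = empiricalKernel (fun i => W₂ i ω) (n₂ m))
    -- the modular and the coupled minimax estimators
    (q₁mod l₁mod q₂mod l₂mod q₁coup l₁coup q₂coup l₂coup : ℕ → Ω' → S × A → ℝ)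
    (hmod : ∀ m, ∀ᵐ ω ∂Pr, M.IsModularEstimator Q₁ Q₂ L₁ L₂ (Phat₁ m ω) (Phat₂ m ω)
      (q₁mod m ω) (l₁mod m ω) (q₂mod m ω) (l₂mod m ω))
    (hcoup : ∀ m, ∀ᵐ ω ∂Pr, M.IsCoupledEstimator β Q₁ Q₂ L₁ L₂ (Phat₁ m ω) (Phat₂ m ω)
      (q₁coup m ω) (l₁coup m ω) (q₂coup m ω) (l₂coup m ω))
    (hq₂mod_meas : ∀ m, AEMeasurable (q₂mod m) Pr)
    (hq₂coup_meas : ∀ m, AEMeasurable (q₂coup m) Pr)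
    -- asymptotic linear representations of the leading empirical perturbations
    (ψop ψres ψ₂ : (S × A) × S → S × A → ℝ)
    (hop : IsAsymptoticallyLinear Pr (transitionLaw M.ρ₁ M.P₁).toMeasure W₁ n₁
      (fun m ω => M.γ₁ • (M.resolvent (Phat₁ m ω) *ᵥ
        ((M.anchored (Phat₁ m ω) - M.anchored (kernelMatrix M.P₁)) *ᵥ M.q₁star))) ψop)
    (hres : IsAsymptoticallyLinear Pr (transitionLaw M.ρ₁ M.P₁).toMeasure W₁ n₁
      (fun m ω => M.resolvent (Phat₁ m ω) *ᵥ M.b₁ (Phat₁ m ω) (q₁mod m ω)) ψres)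
    (htarget : IsAsymptoticallyLinear Pr (transitionLaw M.ρ₂ M.P₂).toMeasure W₂ n₂
      (fun m ω => M.γ₂ • ((Phat₂ m ω - kernelMatrix M.P₂) *ᵥ M.Ω q₂star)) ψ₂)
    -- consistency and rate
    (rate : ℕ → ℝ) (hrate : ∀ m, rate m = (√(n₁ m : ℝ))⁻¹ + (√(n₂ m : ℝ))⁻¹)
    (hq₁mod_cons : TendstoInMeasure Pr q₁mod atTop (fun _ => M.q₁star))
    (hq₂mod_cons : TendstoInMeasure Pr q₂mod atTop (fun _ => q₂star))
    (hq₂coup_cons : TendstoInMeasure Pr q₂coup atTop (fun _ => q₂star))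
    (hq₂mod_rate : IsBigOP Pr (fun m ω => q₂mod m ω - q₂star) rate)
    (hq₂coup_rate : IsBigOP Pr (fun m ω => q₂coup m ω - q₂star) rate)
    -- local stochastic equicontinuity of the target and of the profiled empirical process
    (hmod_equi : StochEquicontinuousAt Pr
      (fun m ω (q : (S × A → ℝ) × (S × A → ℝ)) =>
        M.b₂ (Phat₂ m ω) q.1 q.2 - M.b₂ (kernelMatrix M.P₂) q.1 q.2)
      (M.q₁star, q₂star) rate)
    (hcoup_equi : StochEquicontinuousAt Pr
      (fun m ω (q : S × A → ℝ) =>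
        M.profiledResidual (Phat₁ m ω) (Phat₂ m ω) q
          - M.profiledResidual (kernelMatrix M.P₁) (kernelMatrix M.P₂) q)
      q₂star rate)
    -- local optimality errors in the empirical target and profiled target equations
    (hmod_opt : IsLittleOP Pr (fun m ω => M.b₂ (Phat₂ m ω) (q₁mod m ω) (q₂mod m ω)) rate)
    (hcoup_opt : IsLittleOP Pr
      (fun m ω => M.profiledResidual (Phat₁ m ω) (Phat₂ m ω) (q₂coup m ω)) rate) :
    TendstoInDistribution
        (fun m ω => WithLp.toLp 2 (√(n₂ m : ℝ) • (q₂coup m ω - q₂star))) atTop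
        (id : EuclideanSpace ℝ (S × A) → EuclideanSpace ℝ (S × A)) (fun _ => Pr)
        (multivariateGaussian 0 (M.sandwich q₂star
          (lam • varMatrix (transitionLaw M.ρ₁ M.P₁).toMeasure ψop
            + varMatrix (transitionLaw M.ρ₂ M.P₂).toMeasure ψ₂))) ∧
      TendstoInDistribution
        (fun m ω => WithLp.toLp 2 (√(n₂ m : ℝ) • (q₂mod m ω - q₂star))) atTop
        (id : EuclideanSpace ℝ (S × A) → EuclideanSpace ℝ (S × A)) (fun _ => Pr)
        (multivariateGaussian 0 (M.sandwich q₂star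
          (lam • varMatrix (transitionLaw M.ρ₁ M.P₁).toMeasure (fun w => ψop w - ψres w)
            + varMatrix (transitionLaw M.ρ₂ M.P₂).toMeasure ψ₂))) := by
  have hr : ∀ m, 0 ≤ rate m := fun m => by rw [hrate]; positivity
  have hP₁ : ∀ m ω v, ‖Phat₁ m ω *ᵥ v‖ ≤ ‖v‖ := fun m ω v => by
    rw [hPhat₁]; exact norm_empiricalKernel_mulVec_le _ _ v
  have hL := M.isUnit_one_sub_P₂pi q₂star
  have hb₂ : ∀ P q₁ q₂, M.b₂ P q₁ q₂ = (1 - anchorMatrix M.μ) *ᵥ q₁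
      + (fun x => M.g x.1 + M.C) + (M.γ₂ • (P *ᵥ M.Ω q₂) - q₂) := fun P q₁ q₂ => by
    rw [TransferModel.b₂, add_sub_assoc]
  have hprof : ∀ P P' q, M.profiledResidual P P' q = M.resolvent P *ᵥ M.ug
      + (fun x => M.g x.1 + M.C) + (M.γ₂ • (P' *ᵥ M.Ω q) - q) := fun P P' q => by
    rw [TransferModel.profiledResidual]; abel
  -- This makes the profiled population residual vanish at `q₂star` as well.
  have hresolvent : M.resolvent (kernelMatrix M.P₁) *ᵥ M.ug
      = (1 - anchorMatrix M.μ) *ᵥ M.q₁star := M.resolvent_mulVec _ _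
  have hstar := hq₂star
  rw [hb₂] at hstar
  refine ⟨tendstoInDistribution_of_linearized hW₁ hW₂ hindep hn₁ hn₂ hlam.le hratio hrate hop
      htarget hL hq₂coup_meas ?_,
    tendstoInDistribution_of_linearized hW₁ hW₂ hindep hn₁ hn₂ hlam.le hratio hrate
      (hop.sub hres) htarget hL hq₂mod_meas ?_⟩
  · have hrem := (M.hasFDerivAt_softBellman q₂star).isLittleOP_remainder hr hq₂coup_cons
      hq₂coup_rate
    -- Taylor remainder plus process increment minus empirical residual telescopes to `L (q̂₂ -
    -- q₂star)` minus the empirical profiled residual at `q₂star`. As its population version is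
    -- zero, that residual is the source plus the target noise.
    convert! (hrem.add (hcoup_equi.isLittleOP hq₂coup_cons)).sub hcoup_opt using 3 with m ω
    rw [← M.resolvent_mulVec_ug_sub (hP₁ m ω)]
    simp only [hprof, hresolvent, neg_apply, LinearMap.coe_toContinuousLinearMap',
      Matrix.mulVecLin_apply, Matrix.sub_mulVec (Phat₂ m ω), smul_sub]
    linear_combination (exp := 1) hstar
  · have hrem := (M.hasFDerivAt_softBellman q₂star).isLittleOP_remainder hr hq₂mod_cons
      hq₂mod_rate
    -- The same telescoping now leaves `(I - Π_μ)(q̂₁ - q₁⋆)` as source term, which the two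
    -- resolvent identities rewrite as perturbation minus propagated residual.
    convert! (hrem.add (hmod_equi.isLittleOP (hq₁mod_cons.prodMk_norm hq₂mod_cons))).sub
      hmod_opt using 3 with m ω
    rw [← M.resolvent_mulVec_ug_sub (hP₁ m ω), M.resolvent_mulVec_b₁ (hP₁ m ω)]
    simp only [hb₂, neg_apply, LinearMap.coe_toContinuousLinearMap',
      Matrix.mulVecLin_apply, Matrix.sub_mulVec (Phat₂ m ω), smul_sub]
    linear_combination (exp := 1) hstar
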